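/- Let $\Sigma=(\sigma_{ij})$ be a known symmetric positive definite $3\times 3$ matrix and let $\alpha\in(0,1)$. One observes $T=(T_{AR},T_{LM},T_{FS})\sim N(\mu,\Sigma)$, where the unknown mean $\mu=(\mu_1,\mu_2,\mu_3)$ ranges over $\mathcal M=\{\mu\in\mathbb R^3:\ \mu_1>0,\ \mu_3>0,\ \mu_2^2<\mu_1\mu_3\}$. Consider testing $H_0:\mu\in\mathcal M,\ \mu_2=0$ against $H_1:\mu\in\mathcal M,\ \mu_2\neq 0$. A test is a measurable function $\varphi:\mathbb R^3\to[0,1]$, where $\varphi(T)$ is the probability of rejecting $H_0$ given the three statistics. It is an unbiased level-$\alpha$ test if $E_\mu[\varphi(T)]\le\alpha$ for every $\mu\in H_0$ and $E_\mu[\varphi(T)]\ge\alpha$ for every $\mu\in H_1$. It is uniformly most powerful unbiased (UMPU) at level $\alpha$ if it is an unbiased level-$\alpha$ test and, for every unbiased level-$\alpha$ test $\psi$ and every $\mu\in H_1$, $E_\mu[\psi(T)]\le E_\mu[\varphi(T)]$. Let $\Phi$ be the standard normal distribution function. Then the two-sided LM test, which rejects $H_0$ if and only if $T_{LM}^2/\sigma_{22}>\Phi^{-1}(1-\alpha/2)^2$,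 is the UMPU test at level $\alpha$: it is a UMPU test, its rejection probability equals $\alpha$ at every $\mu\in H_0$, and every UMPU test at level $\alpha$ coincides with it $N(\mu,\Sigma)$-almost surely for every $\mu\in\mathcal M$. -/

import Mathlib

open MeasureTheory ProbabilityTheory

namespace UMPU

noncomputable section

/-- A (possibly randomized) test based on an observation in `X`: a measurable critical function
with values in `[0, 1]`; `φ x` is the probability of rejecting the null when `x` is observed. -/
structure IsTest {X : Type*} [MeasurableSpace X] (φ : X → ℝ) : Prop where
  measurable : Measurable φ
  mem_Icc : ∀ x, φ x ∈ Set.Icc (0 : ℝ) 1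

/-- The rejection probability (power function) of `φ` at the parameter `θ` in the statistical
model `P`. -/
def power {Θ X : Type*} [MeasurableSpace X] (P : Θ → Measure X) (φ : X → ℝ) (θ : Θ) : ℝ :=
  ∫ x, φ x ∂(P θ)

/-- `φ` is an unbiased level-`α` test of the null `H₀` against the alternative `H₁`: its rejection
probability is at most `α` on the null and at least `α` on the alternative. -/
structure IsUnbiasedTest {Θ X : Type*} [MeasurableSpace X] (P : Θ → Measure X) (H₀ H₁ : Set Θ)
    (α : ℝ) (φ : X → ℝ) : Prop where
  isTest : IsTest φ
  level : ∀ θ ∈ H₀, power P φ θ ≤ α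
  unbiased : ∀ θ ∈ H₁, α ≤ power P φ θ

/-- `φ` is a uniformly most powerful unbiased level-`α` test of `H₀` against `H₁`: it is unbiased,
and at every point of the alternative no unbiased level-`α` test has larger power. -/
structure IsUMPUTest {Θ X : Type*} [MeasurableSpace X] (P : Θ → Measure X) (H₀ H₁ : Set Θ)
    (α : ℝ) (φ : X → ℝ) : Prop where
  isUnbiasedTest : IsUnbiasedTest P H₀ H₁ α φ
  most_powerful : ∀ ψ : X → ℝ, IsUnbiasedTest P H₀ H₁ α ψ →
    ∀ θ ∈ H₁, power P ψ θ ≤ power P φ θ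

/-- The `p`-quantile of the standard normal distribution. -/
def normalQuantile (p : ℝ) : ℝ := sInf {x : ℝ | p ≤ cdf (gaussianReal 0 1) x}

/-- The interior `{μ : μ₁ > 0, μ₃ > 0, μ₂² < μ₁ μ₃}` of the space of means
(coordinates `0, 1, 2` stand for `1, 2, 3`). -/
def interiorMeans : Set (EuclideanSpace ℝ (Fin 3)) :=
  {μ | 0 < μ 0 ∧ 0 < μ 2 ∧ (μ 1) ^ 2 < μ 0 * μ 2}

/-- The null hypothesis `μ₂ = 0` in the interior. -/
def nullMeans : Set (EuclideanSpace ℝ (Fin 3)) := {μ | μ ∈ interiorMeans ∧ μ 1 = 0}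

/-- The two-sided alternative `μ₂ ≠ 0` in the interior. -/
def altMeans : Set (EuclideanSpace ℝ (Fin 3)) := {μ | μ ∈ interiorMeans ∧ μ 1 ≠ 0}

/-- The limiting Gaussian model: the observation `T = (T_AR, T_LM, T_FS)` has law `N(μ, S)`,
indexed by its mean `μ`, with known covariance matrix `S`. -/
def gaussianModel (S : Matrix (Fin 3) (Fin 3) ℝ) (μ : EuclideanSpace ℝ (Fin 3)) :
    Measure (EuclideanSpace ℝ (Fin 3)) :=
  multivariateGaussian μ S

open scoped Classical in
/-- The two-sided LM test: reject when `T_LM² / σ₂₂` exceeds the square of the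
`1 - α / 2` standard normal quantile. -/
def lmTest (S : Matrix (Fin 3) (Fin 3) ℝ) (α : ℝ) (t : EuclideanSpace ℝ (Fin 3)) : ℝ :=
  if normalQuantile (1 - α / 2) ^ 2 < (t 1) ^ 2 / S 1 1 then 1 else 0

end

end UMPU

/-!
Put `Y t = ⟪u, t⟫`, with `u` the coordinate vector of the LM statistic in the theorem. Moving the
mean of `N(ν, S)` by `s • S u` tilts the law by `exp (s * Y)`, and every mean is of the form
`ν + s • S u` with `⟪u, ν⟫ = 0`. Along each of these lines the model is thus a one-parameter
exponential family with statistic `Y`, whose null value is `s = 0`.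

Let `ψ` be an unbiased test. Near a null mean `ν` in the parameter set its power is at least `α` for
`s ≠ 0` and at most `α` for `s = 0`, so `∫ ψ = α` and `∫ ψ * Y = 0` under `N(ν, S)`. By analyticity
of the Gaussian model in its mean, both identities hold for all `ν` with `⟪u, ν⟫ = 0`; this is
needed because the null mean `ν` on the line through an alternative may lie outside the parameter
set.

Under these two constraints, maximizing the power at `ν + s • S u` means maximizing
`∫ ψ * (exp (s * Y) - (a + b * Y))` for any `a` and `b`. By strict convexity of `exp` they can be
chosen so that the weight is positive exactly where the two-sided test rejects and vanishes at two
values of `Y` only. The Neyman-Pearson argument then gives both optimality and uniqueness.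
-/

namespace UMPU

open Real Filter Topology Set
open scoped RealInnerProductSpace
open Matrix (toEuclideanCLM)

section LaplaceTransform

variable {Ω : Type*} {mΩ : MeasurableSpace Ω} {P : Measure Ω} {X f g : Ω → ℝ}

lemma mgf_withDensity (hf : AEMeasurable f P) (hf₀ : ∀ ω, 0 ≤ f ω) (s : ℝ) :
    mgf X (P.withDensity fun ω ↦ ENNReal.ofReal (f ω)) s = ∫ ω, f ω * exp (s * X ω) ∂P := by
  rw [mgf, integral_withDensity_eq_integral_toReal_smul₀ (by fun_prop) (by simp)]
  simp [hf₀]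

lemma integrable_exp_mul_withDensity_iff (hf : AEMeasurable f P) (hf₀ : ∀ ω, 0 ≤ f ω) (s : ℝ) :
    Integrable (fun ω ↦ exp (s * X ω)) (P.withDensity fun ω ↦ ENNReal.ofReal (f ω)) ↔
      Integrable (fun ω ↦ f ω * exp (s * X ω)) P := by
  rw [integrable_withDensity_iff_integrable_smul₀' (by fun_prop) (by simp)]
  simp [hf₀]

lemma integrableExpSet_withDensity_eq_univ (hf : AEMeasurable f P) (hf₀ : ∀ ω, 0 ≤ f ω)
    (h : ∀ s, Integrable (fun ω ↦ f ω * exp (s * X ω)) P) :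
    integrableExpSet X (P.withDensity fun ω ↦ ENNReal.ofReal (f ω)) = univ :=
  eq_univ_of_forall fun s ↦ (integrable_exp_mul_withDensity_iff hf hf₀ s).2 (h s)

lemma aemeasurable_of_integrable_mul_exp (h : ∀ s, Integrable (fun ω ↦ f ω * exp (s * X ω)) P) :
    AEMeasurable f P := by
  simpa using (h 0).aemeasurable

lemma hasDerivAt_integral_mul_exp (hf₀ : ∀ ω, 0 ≤ f ω)
    (h : ∀ s, Integrable (fun ω ↦ f ω * exp (s * X ω)) P) (t : ℝ) :
    HasDerivAt (fun s ↦ ∫ ω, f ω * exp (s * X ω) ∂P) (∫ ω, f ω * (X ω * exp (t * X ω)) ∂P) t := by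
  have hf := aemeasurable_of_integrable_mul_exp h
  have hmgf := hasDerivAt_mgf (X := X) (μ := P.withDensity fun ω ↦ ENNReal.ofReal (f ω)) (t := t)
    (by simp [integrableExpSet_withDensity_eq_univ hf hf₀ h])
  rw [integral_withDensity_eq_integral_toReal_smul₀ (by fun_prop) (by simp)] at hmgf
  simpa only [funext (mgf_withDensity (X := X) hf hf₀), ENNReal.toReal_ofReal (hf₀ _),
    smul_eq_mul] using hmgf

lemma analyticOnNhd_integral_mul_exp_of_nonneg (hf₀ : ∀ ω, 0 ≤ f ω)
    (h : ∀ s, Integrable (fun ω ↦ f ω * exp (s * X ω)) P) :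
    AnalyticOnNhd ℝ (fun s ↦ ∫ ω, f ω * exp (s * X ω) ∂P) univ := by
  have hf := aemeasurable_of_integrable_mul_exp h
  have hmgf := analyticOnNhd_mgf (X := X) (μ := P.withDensity fun ω ↦ ENNReal.ofReal (f ω))
  rw [integrableExpSet_withDensity_eq_univ hf hf₀ h, interior_univ] at hmgf
  simpa only [← mgf_withDensity hf hf₀] using hmgf

lemma integrable_max_zero_mul_exp {s : ℝ} (h : Integrable (fun ω ↦ g ω * exp (s * X ω)) P) :
    Integrable (fun ω ↦ max (g ω) 0 * exp (s * X ω)) P := by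
  simpa only [max_mul_of_nonneg _ _ (exp_pos _).le, zero_mul] using h.pos_part

lemma analyticOnNhd_integral_mul_exp (h : ∀ s, Integrable (fun ω ↦ g ω * exp (s * X ω)) P) :
    AnalyticOnNhd ℝ (fun s ↦ ∫ ω, g ω * exp (s * X ω) ∂P) univ := by
  have hpos s := integrable_max_zero_mul_exp (h s)
  have hneg s : Integrable (fun ω ↦ max (-g ω) 0 * exp (s * X ω)) P :=
    integrable_max_zero_mul_exp (by simpa only [neg_mul] using (h s).fun_neg)
  refine ((analyticOnNhd_integral_mul_exp_of_nonneg (fun _ ↦ le_max_right _ _) hpos).sub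
    (analyticOnNhd_integral_mul_exp_of_nonneg (fun _ ↦ le_max_right _ _) hneg)).congr
    isOpen_univ fun s _ ↦ ?_
  rw [Pi.sub_apply, ← integral_sub (hpos s) (hneg s)]
  congr 1 with ω
  rw [← sub_mul, max_zero_sub_max_neg_zero_eq_self]

lemma integral_mul_exp_eq_zero_of_eventually
    (h : ∀ s, Integrable (fun ω ↦ g ω * exp (s * X ω)) P)
    (h₀ : ∀ᶠ s in 𝓝 (0 : ℝ), ∫ ω, g ω * exp (s * X ω) ∂P = 0) (s : ℝ) :
    ∫ ω, g ω * exp (s * X ω) ∂P = 0 :=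
  (analyticOnNhd_integral_mul_exp h).eqOn_zero_of_preconnected_of_eventuallyEq_zero
    isPreconnected_univ (mem_univ 0) h₀ (mem_univ s)

end LaplaceTransform

section Gaussian

lemma integrable_exp_mul_of_hasLaw_gaussianReal {Ω : Type*} {_ : MeasurableSpace Ω}
    {P : Measure Ω} {Y : Ω → ℝ} {m : ℝ} {v : NNReal} (hY : HasLaw Y (gaussianReal m v) P) (s : ℝ) :
    Integrable (fun ω ↦ exp (s * Y ω)) P :=
  Integrable.comp_aemeasurable (g := fun y ↦ exp (s * y))
    (hY.map_eq ▸ integrable_exp_mul_gaussianReal s) hY.aemeasurable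

lemma ext_of_integral_exp_inner {E : Type*} [NormedAddCommGroup E] [InnerProductSpace ℝ E]
    [CompleteSpace E] [SecondCountableTopology E] [MeasurableSpace E] [BorelSpace E]
    {P Q : Measure E} [IsProbabilityMeasure P] [IsFiniteMeasure Q]
    (hP : ∀ u : E, Integrable (fun t ↦ exp ⟪u, t⟫) P)
    (h : ∀ u : E, ∫ t, exp ⟪u, t⟫ ∂P = ∫ t, exp ⟪u, t⟫ ∂Q) : P = Q := by
  refine Measure.ext_of_charFun (funext fun u ↦ ?_)
  have hset : integrableExpSet (fun t ↦ ⟪u, t⟫) P = univ :=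
    eq_univ_of_forall fun s ↦ by simpa [integrableExpSet, real_inner_smul_left] using hP (s • u)
  have hmgf : mgf (fun t ↦ ⟪u, t⟫) P = mgf (fun t ↦ ⟪u, t⟫) Q :=
    funext fun s ↦ by simpa [mgf, real_inner_smul_left] using h (s • u)
  have hI := eqOn_complexMGF_of_mgf hmgf (x := Complex.I) (by simp [hset])
  simp only [charFun_apply, complexMGF] at hI ⊢
  simpa [mul_comm, real_inner_comm] using hI

variable {ι : Type*} [Fintype ι] [DecidableEq ι] {S : Matrix ι ι ℝ}
  {ν d u : EuclideanSpace ℝ ι} {g : EuclideanSpace ℝ ι → ℝ}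

lemma inner_toEuclideanCLM_comm (hS : S.IsHermitian) (u v : EuclideanSpace ℝ ι) :
    ⟪u, toEuclideanCLM (𝕜 := ℝ) S v⟫ = ⟪v, toEuclideanCLM (𝕜 := ℝ) S u⟫ := by
  have hS' : IsSelfAdjoint (toEuclideanCLM (𝕜 := ℝ) S) := hS.isSelfAdjoint.map _
  rw [← hS'.isSymmetric.apply_clm, real_inner_comm]

lemma inner_toEuclideanCLM_self_nonneg (hS : S.PosSemidef) (u : EuclideanSpace ℝ ι) :
    0 ≤ ⟪u, toEuclideanCLM (𝕜 := ℝ) S u⟫ := by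
  simpa [Matrix.inner_toEuclideanCLM] using hS.dotProduct_mulVec_nonneg u.ofLp

lemma inner_toEuclideanCLM_self_pos (hS : S.PosDef) (hu : u ≠ 0) :
    0 < ⟪u, toEuclideanCLM (𝕜 := ℝ) S u⟫ := by
  simpa [Matrix.inner_toEuclideanCLM] using hS.dotProduct_mulVec_pos (x := u.ofLp) (by simpa)

lemma exists_toEuclideanCLM_eq (hS : S.PosDef) (d : EuclideanSpace ℝ ι) :
    ∃ θ, toEuclideanCLM (𝕜 := ℝ) S θ = d := by
  have hinv : toEuclideanCLM (𝕜 := ℝ) S * toEuclideanCLM (𝕜 := ℝ) S⁻¹ = 1 := by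
    rw [← map_mul, Matrix.mul_nonsing_inv _ ((Matrix.isUnit_iff_isUnit_det _).1 hS.isUnit), map_one]
  exact ⟨toEuclideanCLM (𝕜 := ℝ) S⁻¹ d, DFunLike.congr_fun hinv d⟩

lemma variance_inner_multivariateGaussian (hS : S.PosSemidef) (ν u : EuclideanSpace ℝ ι) :
    Var[fun t ↦ ⟪u, t⟫; multivariateGaussian ν S] = ⟪u, toEuclideanCLM (𝕜 := ℝ) S u⟫ := by
  rw [← covariance_self (by fun_prop), Matrix.inner_toEuclideanCLM,
    ← covarianceBilin_multivariateGaussian hS,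
    covarianceBilin_apply_eq_cov IsGaussian.memLp_two_id u u]

lemma hasLaw_inner_multivariateGaussian (hS : S.PosSemidef) (ν u : EuclideanSpace ℝ ι) :
    HasLaw (fun t ↦ ⟪u, t⟫) (gaussianReal ⟪u, ν⟫ ⟪u, toEuclideanCLM (𝕜 := ℝ) S u⟫.toNNReal)
      (multivariateGaussian ν S) where
  map_eq := by
    have h := IsGaussian.map_eq_gaussianReal (μ := multivariateGaussian ν S) (innerSL ℝ u)
    rw [(innerSL ℝ u).integral_comp_comm IsGaussian.integrable_fun_id,
      integral_id_multivariateGaussian] at h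
    simpa [variance_inner_multivariateGaussian hS] using h

lemma mgf_inner_multivariateGaussian (hS : S.PosSemidef) (ν u : EuclideanSpace ℝ ι) (s : ℝ) :
    mgf (fun t ↦ ⟪u, t⟫) (multivariateGaussian ν S) s =
      exp (s * ⟪u, ν⟫ + s ^ 2 * ⟪u, toEuclideanCLM (𝕜 := ℝ) S u⟫ / 2) := by
  rw [mgf_gaussianReal (hasLaw_inner_multivariateGaussian hS ν u).map_eq,
    Real.coe_toNNReal _ (inner_toEuclideanCLM_self_nonneg hS u)]
  ring_nf

lemma integrable_exp_inner_multivariateGaussian (hS : S.PosSemidef) (ν u : EuclideanSpace ℝ ι)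
    (s : ℝ) : Integrable (fun t ↦ exp (s * ⟪u, t⟫)) (multivariateGaussian ν S) :=
  integrable_exp_mul_of_hasLaw_gaussianReal (hasLaw_inner_multivariateGaussian hS ν u) s

lemma integrable_inner_mul_exp_inner_multivariateGaussian (hS : S.PosSemidef)
    (ν u v : EuclideanSpace ℝ ι) (s : ℝ) :
    Integrable (fun t ↦ ⟪u, t⟫ * exp (s * ⟪v, t⟫)) (multivariateGaussian ν S) := by
  have hu : MemLp (fun t ↦ ⟪u, t⟫) 2 (multivariateGaussian ν S) :=
    IsGaussian.memLp_two_id.const_inner u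
  have hv : MemLp (fun t ↦ exp (s * ⟪v, t⟫)) 2 (multivariateGaussian ν S) := by
    refine (memLp_two_iff_integrable_sq (by fun_prop)).2 ?_
    simpa only [← exp_nat_mul, Nat.cast_ofNat, mul_assoc] using
      integrable_exp_inner_multivariateGaussian hS ν v (2 * s)
  exact hu.integrable_mul hv

lemma multivariateGaussian_add_eq_tilted (hS : S.PosSemidef) (ν θ : EuclideanSpace ℝ ι) :
    multivariateGaussian (ν + toEuclideanCLM (𝕜 := ℝ) S θ) S =
      (multivariateGaussian ν S).tilted fun t ↦ ⟪θ, t⟫ := by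
  have hexp (ν u : EuclideanSpace ℝ ι) : ∫ t, exp ⟪u, t⟫ ∂(multivariateGaussian ν S) =
      exp (⟪u, ν⟫ + ⟪u, toEuclideanCLM (𝕜 := ℝ) S u⟫ / 2) := by
    simpa [mgf] using mgf_inner_multivariateGaussian hS ν u 1
  refine ext_of_integral_exp_inner
    (fun u ↦ by simpa using integrable_exp_inner_multivariateGaussian hS _ u 1) fun u ↦ ?_
  simp_rw [integral_tilted, smul_eq_mul, div_mul_eq_mul_div, ← exp_add, ← inner_add_left]
  rw [integral_div, hexp, hexp, hexp, ← exp_sub]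
  congr 1
  simp only [map_add, inner_add_left, inner_add_right,
    inner_toEuclideanCLM_comm hS.isHermitian u θ]
  ring

lemma integral_multivariateGaussian_add_smul (hS : S.PosSemidef) (ν θ : EuclideanSpace ℝ ι)
    (g : EuclideanSpace ℝ ι → ℝ) (s : ℝ) :
    ∫ t, g t ∂(multivariateGaussian (ν + s • toEuclideanCLM (𝕜 := ℝ) S θ) S) =
      (∫ t, g t * exp (s * ⟪θ, t⟫) ∂(multivariateGaussian ν S)) /
        mgf (fun t ↦ ⟪θ, t⟫) (multivariateGaussian ν S) s := by
  rw [← map_smul, multivariateGaussian_add_eq_tilted hS, integral_tilted, ← integral_div]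
  simp only [real_inner_smul_left, smul_eq_mul, mgf, mul_comm (g _), div_mul_eq_mul_div]

lemma absolutelyContinuous_multivariateGaussian (hS : S.PosDef) (μ ν : EuclideanSpace ℝ ι) :
    multivariateGaussian μ S ≪ multivariateGaussian ν S := by
  obtain ⟨θ, hθ⟩ := exists_toEuclideanCLM_eq hS (μ - ν)
  rw [← add_sub_cancel ν μ, ← hθ, multivariateGaussian_add_eq_tilted hS.posSemidef]
  exact tilted_absolutelyContinuous _ _

lemma integral_multivariateGaussian_eq_zero_of_eventually (hS : S.PosDef)
    (hg : ∀ (θ : EuclideanSpace ℝ ι) (s : ℝ),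
      Integrable (fun t ↦ g t * exp (s * ⟪θ, t⟫)) (multivariateGaussian ν S))
    (h : ∀ᶠ s in 𝓝 (0 : ℝ), ∫ t, g t ∂(multivariateGaussian (ν + s • d) S) = 0) (s : ℝ) :
    ∫ t, g t ∂(multivariateGaussian (ν + s • d) S) = 0 := by
  obtain ⟨θ, rfl⟩ := exists_toEuclideanCLM_eq hS d
  have key s : ∫ t, g t ∂(multivariateGaussian (ν + s • toEuclideanCLM (𝕜 := ℝ) S θ) S) = 0 ↔
      ∫ t, g t * exp (s * ⟪θ, t⟫) ∂(multivariateGaussian ν S) = 0 := by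
    rw [integral_multivariateGaussian_add_smul hS.posSemidef,
      mgf_inner_multivariateGaussian hS.posSemidef, div_eq_zero_iff, or_iff_left (exp_pos _).ne']
  simp only [key] at h ⊢
  exact integral_mul_exp_eq_zero_of_eventually (hg θ) h s

end Gaussian

section NeymanPearson

variable {Ω : Type*} {mΩ : MeasurableSpace Ω} {P : Measure Ω} {φ ψ f w : Ω → ℝ}
  {X : Type*} {mX : MeasurableSpace X} {Y : X → Ω}

lemma IsTest.integrable_mul (hφ : IsTest φ) (hf : Integrable f P) :
    Integrable (fun ω ↦ φ ω * f ω) P :=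
  hf.bdd_mul hφ.measurable.aestronglyMeasurable <| ae_of_all _ fun ω ↦ by
    simpa only [norm_eq_abs, abs_of_nonneg (hφ.mem_Icc ω).1] using (hφ.mem_Icc ω).2

lemma IsTest.integrable [IsFiniteMeasure P] (hφ : IsTest φ) : Integrable φ P := by
  simpa using hφ.integrable_mul (integrable_const (μ := P) (1 : ℝ))

lemma IsTest.comp (hφ : IsTest φ) (hY : Measurable Y) : IsTest (φ ∘ Y) :=
  ⟨hφ.measurable.comp hY, fun _ ↦ hφ.mem_Icc _⟩

/-- A Neyman-Pearson test for the weight `w`: it accepts where `w < 0` and rejects where `0 < w`,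
so that it maximizes `∫ φ * w` among all tests. What it does on `{w = 0}` is left free. -/
structure IsNeymanPearsonTest {Ω : Type*} [MeasurableSpace Ω] (w φ : Ω → ℝ) : Prop
    extends IsTest φ where
  eq_zero_of_neg : ∀ ω, w ω < 0 → φ ω = 0
  eq_one_of_pos : ∀ ω, 0 < w ω → φ ω = 1

lemma IsNeymanPearsonTest.comp (hφ : IsNeymanPearsonTest w φ) (hY : Measurable Y) :
    IsNeymanPearsonTest (w ∘ Y) (φ ∘ Y) :=
  ⟨hφ.toIsTest.comp hY, fun _ ↦ hφ.eq_zero_of_neg _, fun _ ↦ hφ.eq_one_of_pos _⟩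

lemma IsNeymanPearsonTest.sub_mul_nonneg (hφ : IsNeymanPearsonTest w φ) (hψ : IsTest ψ) (ω : Ω) :
    0 ≤ (φ ω - ψ ω) * w ω := by
  obtain ⟨hψ₀, hψ₁⟩ := hψ.mem_Icc ω
  rcases lt_trichotomy (w ω) 0 with h | h | h
  · exact mul_nonneg_of_nonpos_of_nonpos (by simpa [hφ.eq_zero_of_neg ω h] using hψ₀) h.le
  · simp [h]
  · exact mul_nonneg (by simpa [hφ.eq_one_of_pos ω h] using hψ₁) h.le

lemma IsNeymanPearsonTest.integral_mul_le (hφ : IsNeymanPearsonTest w φ) (hψ : IsTest ψ)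
    (hw : Integrable w P) : ∫ ω, ψ ω * w ω ∂P ≤ ∫ ω, φ ω * w ω ∂P :=
  integral_mono (hψ.integrable_mul hw) (hφ.integrable_mul hw) fun ω ↦
    sub_nonneg.1 <| by simpa only [← sub_mul] using hφ.sub_mul_nonneg hψ ω

lemma IsNeymanPearsonTest.ae_eq_of_integral_mul_eq (hφ : IsNeymanPearsonTest w φ) (hψ : IsTest ψ)
    (hw : Integrable w P) (hw₀ : ∀ᵐ ω ∂P, w ω ≠ 0)
    (h : ∫ ω, ψ ω * w ω ∂P = ∫ ω, φ ω * w ω ∂P) : ψ =ᵐ[P] φ := by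
  have hint : Integrable (fun ω ↦ (φ ω - ψ ω) * w ω) P := by
    simp_rw [sub_mul]
    exact (hφ.integrable_mul hw).sub (hψ.integrable_mul hw)
  have hzero : ∫ ω, (φ ω - ψ ω) * w ω ∂P = 0 := by
    simp_rw [sub_mul]
    rw [integral_sub (hφ.integrable_mul hw) (hψ.integrable_mul hw), h, sub_self]
  filter_upwards [(integral_eq_zero_iff_of_nonneg (hφ.sub_mul_nonneg hψ) hint).1 hzero, hw₀]
    with ω hω hω₀
  exact (sub_eq_zero.1 <| (mul_eq_zero.1 hω).resolve_right hω₀).symm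

end NeymanPearson

section Quantile

variable {P : Measure ℝ} [IsProbabilityMeasure P]

lemma continuous_cdf [NullSingletonClass P] : Continuous (cdf P) := by
  refine continuous_iff_continuousAt.2 fun x ↦ ?_
  rw [(cdf P).mono.continuousAt_iff_leftLim_eq_rightLim, StieltjesFunction.rightLim_eq]
  refine le_antisymm ((cdf P).mono.leftLim_le le_rfl) ?_
  have hx := measure_singleton (μ := P) x
  rw [← measure_cdf P, StieltjesFunction.measure_singleton, ENNReal.ofReal_eq_zero] at hx
  exact sub_nonpos.1 hx

lemma cdf_sInf_setOf_le_cdf [NullSingletonClass P] {p : ℝ} (h₀ : 0 < p) (h₁ : p < 1) :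
    cdf P (sInf {x | p ≤ cdf P x}) = p := by
  obtain ⟨a, ha⟩ := ((tendsto_cdf_atBot P).eventually_lt_const h₀).exists
  obtain ⟨b, hb⟩ := ((tendsto_cdf_atTop P).eventually_const_lt h₁).exists
  obtain ⟨x, hx⟩ := mem_range_of_exists_le_of_exists_ge (continuous_cdf (P := P))
    ⟨a, ha.le⟩ ⟨b, hb.le⟩
  have hbdd : BddBelow {x | p ≤ cdf P x} :=
    ⟨a, fun y hy ↦ (((cdf P).mono.reflect_lt (ha.trans_le hy))).le⟩
  refine le_antisymm ?_ ((isClosed_le continuous_const continuous_cdf).csInf_mem ⟨x, hx.ge⟩ hbdd)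
  exact ((cdf P).mono (csInf_le hbdd hx.ge)).trans hx.le

lemma measureReal_Ioi_eq_one_sub_cdf (x : ℝ) : P.real (Ioi x) = 1 - cdf P x := by
  rw [cdf_eq_real, ← compl_Iic, probReal_compl_eq_one_sub measurableSet_Iic]

lemma measureReal_Iio_neg_eq_one_sub_cdf [P.IsNegInvariant] (x : ℝ) :
    P.real (Iio (-x)) = 1 - cdf P x := by
  rw [← measureReal_Ioi_eq_one_sub_cdf, measureReal_def, ← neg_Ioi, Measure.measure_neg,
    measureReal_def]

lemma cdf_zero_eq_half [P.IsNegInvariant] [NullSingletonClass P] : cdf P 0 = 1 / 2 := by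
  have h : cdf P 0 = 1 - cdf P 0 := by
    rw [← measureReal_Iio_neg_eq_one_sub_cdf, neg_zero, cdf_eq_real,
      measureReal_congr Iio_ae_eq_Iic]
  linarith

lemma measureReal_sq_lt_sq [P.IsNegInvariant] {c : ℝ} (hc : 0 ≤ c) :
    P.real {y | c ^ 2 < y ^ 2} = 2 * (1 - cdf P c) := by
  have hset : {y : ℝ | c ^ 2 < y ^ 2} = Iio (-c) ∪ Ioi c := by
    ext y
    simp [sq_lt_sq, abs_of_nonneg hc, lt_abs, lt_neg, or_comm]
  have hdisj : Disjoint (Iio (-c)) (Ioi c) :=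
    (Iio_disjoint_Ici le_rfl).mono_right fun y (hy : c < y) ↦ by
      simp only [mem_Ici]
      linarith
  rw [hset, measureReal_union hdisj measurableSet_Ioi, measureReal_Ioi_eq_one_sub_cdf,
    measureReal_Iio_neg_eq_one_sub_cdf, two_mul]

instance isNegInvariant_gaussianReal (v : NNReal) : (gaussianReal 0 v).IsNegInvariant where
  neg_eq_self := by
    have h := gaussianReal_map_neg (μ := 0) (v := v)
    rwa [neg_zero] at h

lemma cdf_normalQuantile {p : ℝ} (h₀ : 0 < p) (h₁ : p < 1) :
    cdf (gaussianReal 0 1) (normalQuantile p) = p :=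
  have := nullSingletonClass_gaussianReal (μ := 0) one_ne_zero
  cdf_sInf_setOf_le_cdf h₀ h₁

lemma normalQuantile_pos {p : ℝ} (h₀ : 1 / 2 < p) (h₁ : p < 1) : 0 < normalQuantile p := by
  have := nullSingletonClass_gaussianReal (μ := 0) one_ne_zero
  refine (monotone_cdf (gaussianReal 0 1)).reflect_lt ?_
  rwa [cdf_zero_eq_half, cdf_normalQuantile (by linarith) h₁]

end Quantile

section TwoSidedTest

variable {c s x y : ℝ} {f : ℝ → ℝ}

lemma exists_sign_sub_affine_eq (hf : StrictConvexOn ℝ univ f) (hxy : x ≠ y) :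
    ∃ a b, ∀ z, SignType.sign (f z - (a + b * z)) = SignType.sign ((z - x) * (z - y)) := by
  refine ⟨f x - slope f x y * x, slope f x y, fun z ↦ ?_⟩
  rcases eq_or_ne z x with rfl | hzx
  · simp
  have hfactor : f z - (f x - slope f x y * x + slope f x y * z) =
      (z - x) * (slope f x z - slope f x y) := by
    rw [slope_def_field f x z, mul_sub, mul_div_cancel₀ _ (sub_ne_zero.2 hzx)]
    ring
  have hslope : StrictMonoOn (slope f x) {x}ᶜ := fun z hz w hw hzw ↦ by
    simpa only [slope_def_field] using
      hf.secant_strict_mono (mem_univ x) (mem_univ z) (mem_univ w) hz hw hzw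
  rw [hfactor, sign_mul, sign_mul]
  congr 1
  rcases lt_trichotomy z y with h | rfl | h
  · rw [sign_neg (sub_neg.2 h), sign_neg (sub_neg.2 (hslope hzx hxy.symm h))]
  · simp
  · rw [sign_pos (sub_pos.2 h), sign_pos (sub_pos.2 (hslope hxy.symm hzx h))]

lemma exists_sign_exp_mul_sub_affine_eq (hs : s ≠ 0) (hc : c ≠ 0) :
    ∃ a b, ∀ y, SignType.sign (exp (s * y) - (a + b * y)) = SignType.sign (y ^ 2 - c ^ 2) := by
  -- The chord of `exp` over the interval between `-s * c` and `s * c`.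
  obtain ⟨a, b, h⟩ := exists_sign_sub_affine_eq strictConvexOn_exp (x := s * -c) (y := s * c)
    (by simpa [hs, neg_eq_iff_add_eq_zero] using hc)
  refine ⟨a, b * s, fun y ↦ ?_⟩
  have hfactor : (s * y - s * -c) * (s * y - s * c) = s ^ 2 * (y ^ 2 - c ^ 2) := by ring
  rw [mul_assoc, h, hfactor, sign_mul, sign_pos (by positivity), one_mul]

/-- The two-sided z-test of size `α` for a centred Gaussian statistic of variance `v`, as a function
of the value of the statistic. -/
noncomputable def zTest (v α : ℝ) : ℝ → ℝ :=
  {y | normalQuantile (1 - α / 2) ^ 2 < y ^ 2 / v}.indicator 1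

variable {v α : ℝ}

lemma measurableSet_zTest : MeasurableSet {y | normalQuantile (1 - α / 2) ^ 2 < y ^ 2 / v} :=
  measurableSet_lt measurable_const (by fun_prop)

lemma isTest_zTest (v α : ℝ) : IsTest (zTest v α) where
  measurable := measurable_one.indicator measurableSet_zTest
  mem_Icc y := ⟨indicator_nonneg (fun _ _ ↦ zero_le_one) y,
    indicator_apply_le' (fun _ ↦ le_rfl) fun _ ↦ zero_le_one⟩

lemma exists_isNeymanPearsonTest_zTest (hv : 0 < v) (hα₀ : 0 < α) (hα₁ : α < 1) (hs : s ≠ 0) :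
    ∃ a b, IsNeymanPearsonTest (fun y ↦ exp (s * y) - (a + b * y)) (zTest v α) ∧
      {y | exp (s * y) - (a + b * y) = 0}.Finite := by
  have hq : 0 < normalQuantile (1 - α / 2) := normalQuantile_pos (by linarith) (by linarith)
  set q := normalQuantile (1 - α / 2)
  obtain ⟨a, b, h⟩ := exists_sign_exp_mul_sub_affine_eq hs (mul_pos (sqrt_pos.2 hv) hq).ne'
  have hlt (y : ℝ) : q ^ 2 < y ^ 2 / v ↔ 0 < y ^ 2 - (√v * q) ^ 2 := by
    rw [lt_div_iff₀ hv, sub_pos, mul_pow, sq_sqrt hv.le, mul_comm]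
  refine ⟨a, b, ⟨isTest_zTest v α, fun y hy ↦ ?_, fun y hy ↦ ?_⟩, ?_⟩
  · refine indicator_of_notMem (fun hmem ↦ ?_) _
    rw [← sign_eq_neg_one_iff, h, sign_eq_neg_one_iff] at hy
    exact ((hlt y).1 hmem).not_gt hy
  · rw [← sign_eq_one_iff, h, sign_eq_one_iff] at hy
    exact indicator_of_mem (f := (1 : ℝ → ℝ)) ((hlt y).2 hy)
  · refine (toFinite {√v * q, -(√v * q)}).subset fun y hy ↦ ?_
    rwa [mem_ofPred_eq, ← _root_.sign_eq_zero_iff, h, _root_.sign_eq_zero_iff, sub_eq_zero,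
      sq_eq_sq_iff_eq_or_eq_neg] at hy

variable {Ω : Type*} {mΩ : MeasurableSpace Ω} {P : Measure Ω} {Y ψ : Ω → ℝ}

/-- A locally unbiased test of size `α` at the distribution `P` with centred score `Y`: its size is
`α` and its power has derivative zero at `P` in the direction of the score. -/
structure IsLocallyUnbiasedTest {Ω : Type*} [MeasurableSpace Ω] (P : Measure Ω) (Y : Ω → ℝ) (α : ℝ)
    (ψ : Ω → ℝ) : Prop extends IsTest ψ where
  size : ∫ ω, ψ ω ∂P = α
  score : ∫ ω, ψ ω * Y ω ∂P = 0

lemma IsLocallyUnbiasedTest.integral_mul_sub [IsFiniteMeasure P] {f : Ω → ℝ}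
    (hψ : IsLocallyUnbiasedTest P Y α ψ) (hf : Integrable f P) (hY : Integrable Y P) (a b : ℝ) :
    ∫ ω, ψ ω * (f ω - (a + b * Y ω)) ∂P = ∫ ω, ψ ω * f ω ∂P - a * α := by
  have hψa := (hψ.integrable (P := P)).const_mul a
  have hψY := (hψ.integrable_mul hY).const_mul b
  have hsplit (ω : Ω) :
      ψ ω * (f ω - (a + b * Y ω)) = ψ ω * f ω - (a * ψ ω + b * (ψ ω * Y ω)) := by ring
  simp_rw [hsplit]
  rw [integral_sub (hψ.integrable_mul hf) (hψa.fun_add hψY), integral_add hψa hψY,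
    integral_const_mul, integral_const_mul, hψ.size, hψ.score, mul_zero, add_zero]

lemma integrable_of_hasLaw_gaussianReal {m : ℝ} {v : NNReal} (hY : HasLaw Y (gaussianReal m v) P) :
    Integrable Y P :=
  Integrable.comp_aemeasurable (g := fun y ↦ y)
    (hY.map_eq ▸ IsGaussian.integrable_fun_id) hY.aemeasurable

lemma integral_zTest_comp (hv : 0 < v) (hα₀ : 0 < α) (hα₁ : α < 1)
    (hY : HasLaw Y (gaussianReal 0 v.toNNReal) P) : ∫ ω, zTest v α (Y ω) ∂P = α := by
  have hq : 0 < normalQuantile (1 - α / 2) := normalQuantile_pos (by linarith) (by linarith)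
  have hstd : HasLaw (fun ω ↦ Y ω / √v) (gaussianReal 0 1) P := by
    convert gaussianReal_div_const hY √v
    · simp
    · ext
      simp [sq_sqrt hv.le, hv.le, hv.ne']
  rw [← Function.comp_def, hY.integral_comp (isTest_zTest v α).measurable.aestronglyMeasurable,
    zTest, integral_indicator_one measurableSet_zTest, ← hY.measureReal_eq measurableSet_zTest]
  have hdiv (y : ℝ) : y ^ 2 / v = (y / √v) ^ 2 := by rw [div_pow, sq_sqrt hv.le]
  simp_rw [hdiv]
  rw [hstd.measureReal_eq (p := fun y ↦ normalQuantile (1 - α / 2) ^ 2 < y ^ 2)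
    (measurableSet_lt measurable_const (by fun_prop)), measureReal_sq_lt_sq hq.le,
    cdf_normalQuantile (by linarith) (by linarith)]
  ring

lemma integral_zTest_comp_mul_eq_zero (hY : HasLaw Y (gaussianReal 0 v.toNNReal) P) :
    ∫ ω, zTest v α (Y ω) * Y ω ∂P = 0 := by
  have hodd (y : ℝ) : zTest v α (-y) * -y = -(zTest v α y * y) := by
    simp [zTest, indicator_apply]
  have hmeas : Measurable fun y ↦ zTest v α y * y := (isTest_zTest v α).measurable.mul measurable_id
  have hneg := integral_neg_eq_self (fun y ↦ zTest v α y * y) (gaussianReal 0 v.toNNReal)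
  simp_rw [hodd, integral_neg] at hneg
  exact (hY.integral_comp hmeas.aestronglyMeasurable).trans (neg_eq_self.1 hneg)

lemma isLocallyUnbiasedTest_zTest_comp (hv : 0 < v) (hα₀ : 0 < α) (hα₁ : α < 1)
    (hYm : Measurable Y) (hY : HasLaw Y (gaussianReal 0 v.toNNReal) P) :
    IsLocallyUnbiasedTest P Y α (zTest v α ∘ Y) where
  toIsTest := (isTest_zTest v α).comp hYm
  size := integral_zTest_comp hv hα₀ hα₁ hY
  score := integral_zTest_comp_mul_eq_zero hY

lemma isLocallyUnbiasedTest_const [IsProbabilityMeasure P] (hα₀ : 0 ≤ α) (hα₁ : α ≤ 1)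
    (hY : ∫ ω, Y ω ∂P = 0) : IsLocallyUnbiasedTest P Y α fun _ ↦ α where
  measurable := measurable_const
  mem_Icc _ := ⟨hα₀, hα₁⟩
  size := by simp
  score := by rw [integral_const_mul, hY, mul_zero]

lemma exists_isNeymanPearsonTest_zTest_comp (hv : 0 < v) (hα₀ : 0 < α) (hα₁ : α < 1) (hs : s ≠ 0)
    (hYm : Measurable Y) (hY : HasLaw Y (gaussianReal 0 v.toNNReal) P) :
    ∃ (w : Ω → ℝ) (k : ℝ), Integrable w P ∧ (∀ᵐ ω ∂P, w ω ≠ 0) ∧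
      IsNeymanPearsonTest w (zTest v α ∘ Y) ∧ ∀ ψ, IsLocallyUnbiasedTest P Y α ψ →
        ∫ ω, ψ ω * w ω ∂P = ∫ ω, ψ ω * exp (s * Y ω) ∂P - k := by
  have := hY.isFiniteMeasure
  have := nullSingletonClass_gaussianReal (μ := 0) (v := v.toNNReal) (by simpa)
  obtain ⟨a, b, hNP, hfin⟩ := exists_isNeymanPearsonTest_zTest hv hα₀ hα₁ hs
  have hexp := integrable_exp_mul_of_hasLaw_gaussianReal hY s
  have hYi := integrable_of_hasLaw_gaussianReal hY
  refine ⟨fun ω ↦ exp (s * Y ω) - (a + b * Y ω), a * α,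
    hexp.sub ((integrable_const a).add (hYi.const_mul b)), ?_, hNP.comp hYm,
    fun ψ hψ ↦ hψ.integral_mul_sub hexp hYi a b⟩
  exact (hY.ae_iff (p := fun y ↦ exp (s * y) - (a + b * y) ≠ 0) (by fun_prop)).2
    (hfin.countable.ae_notMem _)

lemma IsLocallyUnbiasedTest.integral_mul_exp_le (hψ : IsLocallyUnbiasedTest P Y α ψ) (hv : 0 < v)
    (hα₀ : 0 < α) (hα₁ : α < 1) (hs : s ≠ 0) (hYm : Measurable Y)
    (hY : HasLaw Y (gaussianReal 0 v.toNNReal) P) :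
    ∫ ω, ψ ω * exp (s * Y ω) ∂P ≤ ∫ ω, zTest v α (Y ω) * exp (s * Y ω) ∂P := by
  obtain ⟨w, k, hw, -, hNP, hk⟩ := exists_isNeymanPearsonTest_zTest_comp hv hα₀ hα₁ hs hYm hY
  have hle := hNP.integral_mul_le hψ.toIsTest hw
  rwa [hk ψ hψ, hk _ (isLocallyUnbiasedTest_zTest_comp hv hα₀ hα₁ hYm hY),
    sub_le_sub_iff_right] at hle

lemma IsLocallyUnbiasedTest.ae_eq_of_integral_mul_exp_eq (hψ : IsLocallyUnbiasedTest P Y α ψ)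
    (hv : 0 < v) (hα₀ : 0 < α) (hα₁ : α < 1) (hs : s ≠ 0) (hYm : Measurable Y)
    (hY : HasLaw Y (gaussianReal 0 v.toNNReal) P)
    (h : ∫ ω, ψ ω * exp (s * Y ω) ∂P = ∫ ω, zTest v α (Y ω) * exp (s * Y ω) ∂P) :
    ψ =ᵐ[P] zTest v α ∘ Y := by
  obtain ⟨w, k, hw, hw₀, hNP, hk⟩ := exists_isNeymanPearsonTest_zTest_comp hv hα₀ hα₁ hs hYm hY
  refine hNP.ae_eq_of_integral_mul_eq hψ.toIsTest hw hw₀ ?_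
  rw [hk ψ hψ, hk _ (isLocallyUnbiasedTest_zTest_comp hv hα₀ hα₁ hYm hY), h]
  rfl

end TwoSidedTest

section LinearFunctional

lemma eventually_add_smul_mem {E : Type*} [AddCommGroup E] [Module ℝ E] [TopologicalSpace E]
    [ContinuousAdd E] [ContinuousSMul ℝ E] {M : Set E} {x : E} (hM : IsOpen M) (hx : x ∈ M)
    (d : E) : ∀ᶠ s in 𝓝 (0 : ℝ), x + s • d ∈ M := by
  have hline : ContinuousAt (fun s : ℝ ↦ x + s • d) 0 := by fun_prop
  exact hline.eventually_mem (hM.mem_nhds (by simpa))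

variable {ι : Type*} [Fintype ι] [DecidableEq ι] {S : Matrix ι ι ℝ} {u ν : EuclideanSpace ℝ ι}
  {M : Set (EuclideanSpace ℝ ι)} {α s : ℝ} {ψ : EuclideanSpace ℝ ι → ℝ}

lemma exists_eq_add_smul_toEuclideanCLM (hS : S.PosDef) (hu : u ≠ 0) (μ : EuclideanSpace ℝ ι) :
    ∃ ν, ∃ s : ℝ, ⟪u, ν⟫ = 0 ∧ μ = ν + s • toEuclideanCLM (𝕜 := ℝ) S u := by
  have hv := (inner_toEuclideanCLM_self_pos hS hu).ne'
  set d := toEuclideanCLM (𝕜 := ℝ) S u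
  refine ⟨μ - (⟪u, μ⟫ / ⟪u, d⟫) • d, ⟪u, μ⟫ / ⟪u, d⟫, ?_, by simp⟩
  rw [inner_sub_right, real_inner_smul_right, div_mul_cancel₀ _ hv, sub_self]

lemma inner_add_smul_toEuclideanCLM_ne_zero (hS : S.PosDef) (hu : u ≠ 0) (hν : ⟪u, ν⟫ = 0) :
    ⟪u, ν + s • toEuclideanCLM (𝕜 := ℝ) S u⟫ ≠ 0 ↔ s ≠ 0 := by
  rw [inner_add_right, hν, zero_add, real_inner_smul_right,
    mul_ne_zero_iff_right (inner_toEuclideanCLM_self_pos hS hu).ne']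

lemma hasDerivAt_power_multivariateGaussian (hS : S.PosSemidef) (hψ : IsTest ψ)
    (u ν : EuclideanSpace ℝ ι) :
    HasDerivAt (fun s : ℝ ↦ power (fun μ ↦ multivariateGaussian μ S) ψ
        (ν + s • toEuclideanCLM (𝕜 := ℝ) S u))
      (∫ t, ψ t * ⟪u, t⟫ ∂(multivariateGaussian ν S) -
        (∫ t, ψ t ∂(multivariateGaussian ν S)) * ⟪u, ν⟫) 0 := by
  have hnum := hasDerivAt_integral_mul_exp (P := multivariateGaussian ν S) (X := fun t ↦ ⟪u, t⟫)
    (fun t ↦ (hψ.mem_Icc t).1)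
    (fun s ↦ hψ.integrable_mul (integrable_exp_inner_multivariateGaussian hS ν u s)) 0
  have hden : HasDerivAt (mgf (fun t ↦ ⟪u, t⟫) (multivariateGaussian ν S)) ⟪u, ν⟫ 0 := by
    rw [funext (mgf_inner_multivariateGaussian hS ν u)]
    have hlin := (hasDerivAt_id (0 : ℝ)).mul_const ⟪u, ν⟫
    have hsq := (((hasDerivAt_id (0 : ℝ)).pow 2).mul_const
      ⟪u, toEuclideanCLM (𝕜 := ℝ) S u⟫).div_const 2
    simpa using (hlin.add hsq).exp
  have h := hnum.fun_div hden (by simp)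
  simp only [power, integral_multivariateGaussian_add_smul hS]
  simpa using h

lemma IsUnbiasedTest.isLocallyUnbiasedTest_of_mem (hS : S.PosDef) (hu : u ≠ 0) (hM : IsOpen M)
    (hψ : IsUnbiasedTest (fun μ ↦ multivariateGaussian μ S) {μ ∈ M | ⟪u, μ⟫ = 0}
      {μ ∈ M | ⟪u, μ⟫ ≠ 0} α ψ) (hνM : ν ∈ M) (hν : ⟪u, ν⟫ = 0) :
    IsLocallyUnbiasedTest (multivariateGaussian ν S) (fun t ↦ ⟪u, t⟫) α ψ := by
  have hderiv := hasDerivAt_power_multivariateGaussian hS.posSemidef hψ.isTest u ν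
  rw [hν, mul_zero, sub_zero] at hderiv
  set β : ℝ → ℝ := fun s ↦ power (fun μ ↦ multivariateGaussian μ S) ψ
    (ν + s • toEuclideanCLM (𝕜 := ℝ) S u)
  have hβ₀ : β 0 = ∫ t, ψ t ∂(multivariateGaussian ν S) := by simp [β, power]
  have hle : ∀ᶠ s in 𝓝[≠] 0, α ≤ β s := by
    filter_upwards [self_mem_nhdsWithin,
      nhdsWithin_le_nhds (eventually_add_smul_mem hM hνM _)] with s hs hsM
    exact hψ.unbiased _ ⟨hsM, (inner_add_smul_toEuclideanCLM_ne_zero hS hu hν).2 hs⟩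
  have hsize : β 0 = α := by
    refine le_antisymm (hβ₀ ▸ hψ.level ν ⟨hνM, hν⟩) ?_
    exact ge_of_tendsto (hderiv.continuousAt.tendsto.mono_left nhdsWithin_le_nhds) hle
  have hmin : IsLocalMin β 0 := by
    filter_upwards [eventually_nhdsWithin_iff.1 hle] with s hs
    rcases eq_or_ne s 0 with rfl | hs₀
    · exact le_rfl
    · exact hsize.trans_le (hs hs₀)
  exact ⟨hψ.isTest, hβ₀ ▸ hsize, hmin.hasDerivAt_eq_zero hderiv⟩

lemma IsLocallyUnbiasedTest.of_eventually_add_smul {d : EuclideanSpace ℝ ι} (hS : S.PosDef)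
    (hψ : ∀ᶠ s in 𝓝 (0 : ℝ),
      IsLocallyUnbiasedTest (multivariateGaussian (ν + s • d) S) (fun t ↦ ⟪u, t⟫) α ψ) (s : ℝ) :
    IsLocallyUnbiasedTest (multivariateGaussian (ν + s • d) S) (fun t ↦ ⟪u, t⟫) α ψ := by
  have hψt : IsTest ψ := hψ.self_of_nhds.toIsTest
  have hsub (μ : EuclideanSpace ℝ ι) : ∫ t, (ψ t - α) ∂(multivariateGaussian μ S) =
      ∫ t, ψ t ∂(multivariateGaussian μ S) - α := by
    rw [integral_sub hψt.integrable (integrable_const _), integral_const, probReal_univ, one_smul]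
  refine ⟨hψt, ?_, ?_⟩
  · refine sub_eq_zero.1 ((hsub _).symm.trans ?_)
    refine integral_multivariateGaussian_eq_zero_of_eventually hS (fun θ s ↦ ?_) ?_ s
    · have hexp := integrable_exp_inner_multivariateGaussian hS.posSemidef ν θ s
      simp_rw [sub_mul]
      exact (hψt.integrable_mul hexp).sub (hexp.const_mul α)
    · filter_upwards [hψ] with s hs
      rw [hsub, hs.size, sub_self]
  · refine integral_multivariateGaussian_eq_zero_of_eventually hS (fun θ s ↦ ?_)
      (hψ.mono fun s hs ↦ hs.score) s
    simpa only [mul_assoc] using hψt.integrable_mul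
      (integrable_inner_mul_exp_inner_multivariateGaussian hS.posSemidef ν u θ s)

lemma IsUnbiasedTest.isLocallyUnbiasedTest {ν₀ : EuclideanSpace ℝ ι} (hS : S.PosDef) (hu : u ≠ 0)
    (hM : IsOpen M) (hν₀M : ν₀ ∈ M) (hν₀ : ⟪u, ν₀⟫ = 0)
    (hψ : IsUnbiasedTest (fun μ ↦ multivariateGaussian μ S) {μ ∈ M | ⟪u, μ⟫ = 0}
      {μ ∈ M | ⟪u, μ⟫ ≠ 0} α ψ) (hν : ⟪u, ν⟫ = 0) :
    IsLocallyUnbiasedTest (multivariateGaussian ν S) (fun t ↦ ⟪u, t⟫) α ψ := by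
  have hline (s : ℝ) : ⟪u, ν₀ + s • (ν - ν₀)⟫ = 0 := by
    rw [inner_add_right, real_inner_smul_right, inner_sub_right, hν, hν₀, sub_zero, mul_zero,
      add_zero]
  have hnear := (eventually_add_smul_mem hM hν₀M (ν - ν₀)).mono fun s hs ↦
    hψ.isLocallyUnbiasedTest_of_mem hS hu hM hs (hline s)
  simpa using IsLocallyUnbiasedTest.of_eventually_add_smul hS hnear 1

lemma hasLaw_inner_multivariateGaussian_of_inner_eq_zero (hS : S.PosSemidef) (hν : ⟪u, ν⟫ = 0) :
    HasLaw (fun t ↦ ⟪u, t⟫) (gaussianReal 0 ⟪u, toEuclideanCLM (𝕜 := ℝ) S u⟫.toNNReal)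
      (multivariateGaussian ν S) :=
  hν ▸ hasLaw_inner_multivariateGaussian hS ν u

lemma power_zTest_inner_of_inner_eq_zero (hS : S.PosDef) (hu : u ≠ 0) (hα₀ : 0 < α) (hα₁ : α < 1)
    (hν : ⟪u, ν⟫ = 0) :
    power (fun μ ↦ multivariateGaussian μ S)
      (fun t ↦ zTest ⟪u, toEuclideanCLM (𝕜 := ℝ) S u⟫ α ⟪u, t⟫) ν = α :=
  integral_zTest_comp (inner_toEuclideanCLM_self_pos hS hu) hα₀ hα₁
    (hasLaw_inner_multivariateGaussian_of_inner_eq_zero hS.posSemidef hν)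

lemma IsLocallyUnbiasedTest.power_le_power_zTest_inner (hS : S.PosDef) (hu : u ≠ 0) (hα₀ : 0 < α)
    (hα₁ : α < 1) (hν : ⟪u, ν⟫ = 0) (hs : s ≠ 0)
    (hψ : IsLocallyUnbiasedTest (multivariateGaussian ν S) (fun t ↦ ⟪u, t⟫) α ψ) :
    power (fun μ ↦ multivariateGaussian μ S) ψ (ν + s • toEuclideanCLM (𝕜 := ℝ) S u) ≤
      power (fun μ ↦ multivariateGaussian μ S)
        (fun t ↦ zTest ⟪u, toEuclideanCLM (𝕜 := ℝ) S u⟫ α ⟪u, t⟫)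
        (ν + s • toEuclideanCLM (𝕜 := ℝ) S u) := by
  simp only [power, integral_multivariateGaussian_add_smul hS.posSemidef]
  refine div_le_div_of_nonneg_right ?_ mgf_nonneg
  exact hψ.integral_mul_exp_le (inner_toEuclideanCLM_self_pos hS hu) hα₀ hα₁ hs (by fun_prop)
    (hasLaw_inner_multivariateGaussian_of_inner_eq_zero hS.posSemidef hν)

lemma IsLocallyUnbiasedTest.ae_eq_zTest_inner (hS : S.PosDef) (hu : u ≠ 0) (hα₀ : 0 < α)
    (hα₁ : α < 1) (hν : ⟪u, ν⟫ = 0) (hs : s ≠ 0)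
    (hψ : IsLocallyUnbiasedTest (multivariateGaussian ν S) (fun t ↦ ⟪u, t⟫) α ψ)
    (h : power (fun μ ↦ multivariateGaussian μ S) ψ (ν + s • toEuclideanCLM (𝕜 := ℝ) S u) =
      power (fun μ ↦ multivariateGaussian μ S)
        (fun t ↦ zTest ⟪u, toEuclideanCLM (𝕜 := ℝ) S u⟫ α ⟪u, t⟫)
        (ν + s • toEuclideanCLM (𝕜 := ℝ) S u)) :
    ψ =ᵐ[multivariateGaussian ν S] fun t ↦ zTest ⟪u, toEuclideanCLM (𝕜 := ℝ) S u⟫ α ⟪u, t⟫ := by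
  have hmgf : mgf (fun t ↦ ⟪u, t⟫) (multivariateGaussian ν S) s ≠ 0 := by
    rw [mgf_inner_multivariateGaussian hS.posSemidef]
    positivity
  simp only [power, integral_multivariateGaussian_add_smul hS.posSemidef,
    div_left_inj' hmgf] at h
  exact hψ.ae_eq_of_integral_mul_exp_eq (inner_toEuclideanCLM_self_pos hS hu) hα₀ hα₁ hs
    (by fun_prop) (hasLaw_inner_multivariateGaussian_of_inner_eq_zero hS.posSemidef hν) h

lemma le_power_zTest_inner (hS : S.PosDef) (hu : u ≠ 0) (hα₀ : 0 < α) (hα₁ : α < 1)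
    (μ : EuclideanSpace ℝ ι) :
    α ≤ power (fun μ ↦ multivariateGaussian μ S)
      (fun t ↦ zTest ⟪u, toEuclideanCLM (𝕜 := ℝ) S u⟫ α ⟪u, t⟫) μ := by
  obtain ⟨ν, s, hν, rfl⟩ := exists_eq_add_smul_toEuclideanCLM hS hu μ
  rcases eq_or_ne s 0 with rfl | hs
  · rw [zero_smul, add_zero, power_zTest_inner_of_inner_eq_zero hS hu hα₀ hα₁ hν]
  have hmean : ∫ t, ⟪u, t⟫ ∂(multivariateGaussian ν S) = 0 := by
    rw [(hasLaw_inner_multivariateGaussian_of_inner_eq_zero hS.posSemidef hν).integral_eq,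
      integral_id_gaussianReal]
  have h := (isLocallyUnbiasedTest_const hα₀.le hα₁.le hmean).power_le_power_zTest_inner hS hu
    hα₀ hα₁ hν hs
  rwa [power, integral_const, probReal_univ, one_smul] at h

lemma isUnbiasedTest_zTest_inner (hS : S.PosDef) (hu : u ≠ 0) (hα₀ : 0 < α) (hα₁ : α < 1)
    (M : Set (EuclideanSpace ℝ ι)) :
    IsUnbiasedTest (fun μ ↦ multivariateGaussian μ S) {μ ∈ M | ⟪u, μ⟫ = 0} {μ ∈ M | ⟪u, μ⟫ ≠ 0} α
      fun t ↦ zTest ⟪u, toEuclideanCLM (𝕜 := ℝ) S u⟫ α ⟪u, t⟫ where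
  isTest := (isTest_zTest _ α).comp (by fun_prop)
  level _ hμ := (power_zTest_inner_of_inner_eq_zero hS hu hα₀ hα₁ hμ.2).le
  unbiased μ _ := le_power_zTest_inner hS hu hα₀ hα₁ μ

lemma IsUMPUTest.ae_eq_zTest_inner (hS : S.PosDef) (hu : u ≠ 0) (hα₀ : 0 < α) (hα₁ : α < 1)
    (hM : IsOpen M) (hνM : ν ∈ M) (hν : ⟪u, ν⟫ = 0)
    (hψ : IsUMPUTest (fun μ ↦ multivariateGaussian μ S) {μ ∈ M | ⟪u, μ⟫ = 0}
      {μ ∈ M | ⟪u, μ⟫ ≠ 0} α ψ) (μ : EuclideanSpace ℝ ι) :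
    ψ =ᵐ[multivariateGaussian μ S] fun t ↦ zTest ⟪u, toEuclideanCLM (𝕜 := ℝ) S u⟫ α ⟪u, t⟫ := by
  obtain ⟨s, hsM, hs⟩ : ∃ s : ℝ, ν + s • toEuclideanCLM (𝕜 := ℝ) S u ∈ M ∧ s ≠ 0 :=
    (((eventually_add_smul_mem hM hνM _).filter_mono nhdsWithin_le_nhds).and
      eventually_mem_nhdsWithin).exists (f := 𝓝[≠] 0)
  have hlocal := hψ.isUnbiasedTest.isLocallyUnbiasedTest_of_mem hS hu hM hνM hν
  have hge := hψ.most_powerful _ (isUnbiasedTest_zTest_inner hS hu hα₀ hα₁ M) _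
    ⟨hsM, (inner_add_smul_toEuclideanCLM_ne_zero hS hu hν).2 hs⟩
  have hle := hlocal.power_le_power_zTest_inner hS hu hα₀ hα₁ hν hs
  exact (absolutelyContinuous_multivariateGaussian hS μ ν).ae_eq
    (hlocal.ae_eq_zTest_inner hS hu hα₀ hα₁ hν hs (hle.antisymm hge))

lemma isUMPUTest_zTest_inner (hS : S.PosDef) (hu : u ≠ 0) (hα₀ : 0 < α) (hα₁ : α < 1)
    (hM : IsOpen M) (hνM : ν ∈ M) (hν : ⟪u, ν⟫ = 0) :
    IsUMPUTest (fun μ ↦ multivariateGaussian μ S) {μ ∈ M | ⟪u, μ⟫ = 0} {μ ∈ M | ⟪u, μ⟫ ≠ 0} α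
      fun t ↦ zTest ⟪u, toEuclideanCLM (𝕜 := ℝ) S u⟫ α ⟪u, t⟫ where
  isUnbiasedTest := isUnbiasedTest_zTest_inner hS hu hα₀ hα₁ M
  most_powerful ψ hψ μ hμ := by
    obtain ⟨ν', s, hν', rfl⟩ := exists_eq_add_smul_toEuclideanCLM hS hu μ
    have hs := (inner_add_smul_toEuclideanCLM_ne_zero hS hu hν').1 hμ.2
    exact (hψ.isLocallyUnbiasedTest hS hu hM hνM hν hν').power_le_power_zTest_inner hS hu
      hα₀ hα₁ hν' hs

end LinearFunctional

section LMTest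

lemma isOpen_interiorMeans : IsOpen interiorMeans := by
  have h (i : Fin 3) : Continuous fun μ : EuclideanSpace ℝ (Fin 3) ↦ μ i := by fun_prop
  exact (isOpen_lt continuous_const (h 0)).inter
    ((isOpen_lt continuous_const (h 2)).inter (isOpen_lt ((h 1).pow 2) ((h 0).mul (h 2))))

lemma nullMeans_eq_setOf_inner_single : nullMeans =
    {μ ∈ interiorMeans | ⟪(EuclideanSpace.single 1 1 : EuclideanSpace ℝ (Fin 3)), μ⟫ = 0} := by
  simp [nullMeans, EuclideanSpace.inner_single_left]

lemma altMeans_eq_setOf_inner_single : altMeans =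
    {μ ∈ interiorMeans | ⟪(EuclideanSpace.single 1 1 : EuclideanSpace ℝ (Fin 3)), μ⟫ ≠ 0} := by
  simp [altMeans, EuclideanSpace.inner_single_left]

lemma lmTest_eq_zTest_inner_single (S : Matrix (Fin 3) (Fin 3) ℝ) (α : ℝ) : lmTest S α =
    fun t ↦ zTest
      ⟪EuclideanSpace.single 1 1, toEuclideanCLM (𝕜 := ℝ) S (EuclideanSpace.single 1 1)⟫ α
      ⟪EuclideanSpace.single 1 1, t⟫ := by
  ext t
  simp [lmTest, zTest, indicator_apply, EuclideanSpace.inner_single_left]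

end LMTest

end UMPU

open UMPU in
open scoped RealInnerProductSpace in
theorem proposition1_general {ι : Type*} [Fintype ι] [DecidableEq ι] {S : Matrix ι ι ℝ}
    (hS : S.PosDef) {u : EuclideanSpace ℝ ι} (hu : u ≠ 0) {α : ℝ} (hα₀ : 0 < α) (hα₁ : α < 1)
    {M : Set (EuclideanSpace ℝ ι)} (hM : IsOpen M) {ν : EuclideanSpace ℝ ι} (hνM : ν ∈ M)
    (hν : ⟪u, ν⟫ = 0) :
    let P : EuclideanSpace ℝ ι → Measure (EuclideanSpace ℝ ι) := fun μ ↦ multivariateGaussian μ S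
    let H₀ := {μ ∈ M | ⟪u, μ⟫ = 0}
    let H₁ := {μ ∈ M | ⟪u, μ⟫ ≠ 0}
    let φ := fun t ↦ zTest ⟪u, Matrix.toEuclideanCLM (𝕜 := ℝ) S u⟫ α ⟪u, t⟫
    IsUMPUTest P H₀ H₁ α φ ∧ (∀ μ, ⟪u, μ⟫ = 0 → power P φ μ = α) ∧
      ∀ ψ, IsUMPUTest P H₀ H₁ α ψ → ∀ μ, ψ =ᵐ[P μ] φ :=
  ⟨isUMPUTest_zTest_inner hS hu hα₀ hα₁ hM hνM hν,
    fun _ ↦ power_zTest_inner_of_inner_eq_zero hS hu hα₀ hα₁,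
    fun _ ↦ IsUMPUTest.ae_eq_zTest_inner hS hu hα₀ hα₁ hM hνM hν⟩

theorem proposition1 (S : Matrix (Fin 3) (Fin 3) ℝ) (hS : S.PosDef)
    (α : ℝ) (hα₀ : 0 < α) (hα₁ : α < 1) :
    UMPU.IsUMPUTest (UMPU.gaussianModel S) UMPU.nullMeans UMPU.altMeans α (UMPU.lmTest S α) ∧
    (∀ μ ∈ UMPU.nullMeans, UMPU.power (UMPU.gaussianModel S) (UMPU.lmTest S α) μ = α) ∧
    (∀ φ : EuclideanSpace ℝ (Fin 3) → ℝ,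
      UMPU.IsUMPUTest (UMPU.gaussianModel S) UMPU.nullMeans UMPU.altMeans α φ →
      ∀ μ ∈ UMPU.interiorMeans, φ =ᵐ[UMPU.gaussianModel S μ] UMPU.lmTest S α) := by
  rw [UMPU.lmTest_eq_zTest_inner_single, UMPU.nullMeans_eq_setOf_inner_single,
    UMPU.altMeans_eq_setOf_inner_single]
  obtain ⟨hUMPU, hsize, hunique⟩ := proposition1_general hS (u := EuclideanSpace.single 1 1)
    (by simp) hα₀ hα₁ UMPU.isOpen_interiorMeans (ν := !₂[1, 0, 1])
    (by simp [UMPU.interiorMeans]) (by simp [EuclideanSpace.inner_single_left])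
  exact ⟨hUMPU, fun μ hμ ↦ hsize μ hμ.2, fun φ hφ μ _ ↦ hunique φ hφ μ⟩
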